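/- A limit group is a finitely generated, fully residually free group. Let $\eta\colon G\hookrightarrow H$ be an inclusion of limit groups, with $G$ freely indecomposable, and suppose that $H$ is obtained from $G$ by adjoining roots $\mathcal{F}(\mathcal{E})$ to $\mathcal{E}$: here $\mathcal{E}$ is a collection of nontrivial abelian subgroups $E'$ of $G$, each $\mathcal{F}(E')$ is a collection of finite index supergroups $i_{E',F}\colon E'\hookrightarrow F$, and $\eta$ extends to a surjection $$\pi\colon\langle G,F : E'=i_{E',F}(E')\rangle_{F\in\mathcal{F}(E'),\,E'\in\mathcal{E}}\twoheadrightarrow H.$$ Let $\Pi_H$ be a one-edged splitting of $H$ with infinite cyclic edge group, with Bass–Serre tree $T$ ($H$ acts on $T$ minimally, without inversions, with exactly one orbit of unoriented edges). Let $S\subset T$ be a minimal $G$-invariant subtree and let $\Pi_G$ be the splitting of $G$ given by the action of $G$ on $S$. Suppose that $\Pi_G$ is one-edged, i.e. $S$ contains an edge and $G$ has one orbit of edges in $S$. For an edge $e$ of $S$ let $E=\mathrm{Stab}_G(e)$ be the edge group of $\Pi_G$ and $\eta_\#(E)=\mathrm{Stab}_H(e)$ the edge group of $\Pi_H$ containing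 its image. Suppose that a new root is adjoined to some member of $\mathcal{E}$ which is hyperbolic in $\Pi_G$: there are $E'\in\mathcal{E}$, containing an element which fixes no vertex of $S$, and $F\in\mathcal{F}(E')$ such that $\pi(F)\not\subseteq\eta(Z_G(E'))$. (If $E'$ is its own centralizer in $G$, as in a reduced system of roots, the last condition says that $\pi(F)\neq\eta(E')$.) Then, for every edge $e$ of $S$, the inclusion $\eta\colon E\hookrightarrow\eta_\#(E)$ is a proper inclusion of finite index. -/

import Mathlib

universe u v w x

set_option linter.checkUnivs false

/-- A limit group: a finitely generated, fully residually free group. -/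
def IsLimitGroup (G : Type u) [Group G] : Prop :=
  Group.FG G ∧
    ∀ X : Finset G, ∃ (n : ℕ) (f : G →* FreeGroup (Fin n)), Set.InjOn f (X : Set G)

/-- `G` is not the free product of two nontrivial subgroups. -/
def IsFreelyIndecomposable (G : Type u) [Group G] : Prop :=
  ∀ A B : Subgroup G,
    Function.Bijective (Monoid.Coprod.lift A.subtype B.subtype) → A = ⊥ ∨ B = ⊥

/-! ### Adjoining roots -/

/-- A collection `(E i)` of nontrivial abelian subgroups of `G` together with, for each `i`,
a collection `(F i j)` of finite index supergroups of `E i`. -/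
structure RootExtensionData (G : Type u) [Group G] where
  /-- index type of the collection of subgroups -/
  ι : Type v
  /-- the subgroups to which roots are adjoined -/
  E : ι → Subgroup G
  nontrivial : ∀ i, E i ≠ ⊥
  abelian : ∀ i, ∀ a ∈ E i, ∀ b ∈ E i, a * b = b * a
  /-- index types of the collections of supergroups -/
  κ : ι → Type w
  /-- the supergroups -/
  F : (i : ι) → κ i → Type x
  group : ∀ i j, Group (F i j)
  /-- the inclusion of `E i` into the supergroup -/
  incl : ∀ i j, E i →* F i j
  incl_injective : ∀ i j, Function.Injective (incl i j)
  finiteIndex : ∀ i j, (incl i j).range.FiniteIndex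

attribute [instance] RootExtensionData.group

namespace RootExtensionData

variable {G : Type u} [Group G] (D : RootExtensionData.{u, v, w, x} G)

/-- The free product of `G` with all the groups `F i j`. -/
abbrev FreeProd : Type (max u v w x) :=
  Monoid.Coprod G (Monoid.CoprodI (fun p : (Σ i, D.κ i) => D.F p.1 p.2))

/-- The copy of `F i j` in the free product. -/
def ofF (i : D.ι) (j : D.κ i) : D.F i j →* D.FreeProd :=
  Monoid.Coprod.inr.comp
    (Monoid.CoprodI.of (M := fun p : (Σ i, D.κ i) => D.F p.1 p.2) (i := ⟨i, j⟩))

/-- The relators identifying `e ∈ E i` with its image in `F i j`. -/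
def relators : Set D.FreeProd :=
  {r | ∃ (i : D.ι) (j : D.κ i) (e : D.E i),
    r = Monoid.Coprod.inl (e : G) * (D.ofF i j (D.incl i j e))⁻¹}

/-- The group `⟨G, F i j : E i = incl i j (E i)⟩`. -/
abbrev Adjunction : Type (max u v w x) :=
  D.FreeProd ⧸ Subgroup.normalClosure D.relators

/-- The canonical map from `G`. -/
def fromBase : G →* D.Adjunction :=
  (QuotientGroup.mk' (Subgroup.normalClosure D.relators)).comp Monoid.Coprod.inl

/-- The canonical map from `F i j`. -/
def fromRoot (i : D.ι) (j : D.κ i) : D.F i j →* D.Adjunction :=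
  (QuotientGroup.mk' (Subgroup.normalClosure D.relators)).comp (D.ofF i j)

/-- `H` is obtained from `G` by adjoining the roots `D`: the inclusion `η` of the finitely
generated group `G` in the finitely generated group `H` extends to a surjection `π` of
`⟨G, F i j : E i = incl i j (E i)⟩` onto `H`. -/
structure IsAdjunctionOfRoots {H : Type*} [Group H] (η : G →* H) (π : D.Adjunction →* H) :
    Prop where
  base_fg : Group.FG G
  top_fg : Group.FG H
  injective : Function.Injective η
  extends_incl : π.comp D.fromBase = η
  surjective : Function.Surjective π

end RootExtensionData

/-! ### Splittings, through actions on Bass–Serre trees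

A group `K` acts on the vertices of a tree through a homomorphism `φ : K →* H`, where `H` acts.
A subtree is given by its set of vertices. -/

section Splittings

variable {H : Type*} [Group H] {V : Type*} [MulAction H V]

/-- `H` acts on the tree `T` by automorphisms and without inversions. -/
structure ActsOnTree (H : Type*) [Group H] {V : Type*} [MulAction H V] (T : SimpleGraph V) :
    Prop where
  isTree : T.IsTree
  adj_smul : ∀ (h : H) (a b : V), T.Adj a b → T.Adj (h • a) (h • b)
  no_inversion : ∀ (h : H) (a b : V), T.Adj a b → ¬ (h • a = b ∧ h • b = a)

/-- `S` is the vertex set of a (nonempty) `K`-invariant subtree of `T`. -/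
structure IsInvariantSubtree (T : SimpleGraph V) {K : Type*} [Group K] (φ : K →* H)
    (S : Set V) : Prop where
  connected : (T.induce S).Connected
  invariant : ∀ (k : K), ∀ a ∈ S, φ k • a ∈ S

/-- `S` is the vertex set of a minimal `K`-invariant subtree of `T`. -/
structure IsMinimalSubtree (T : SimpleGraph V) {K : Type*} [Group K] (φ : K →* H)
    (S : Set V) : Prop extends IsInvariantSubtree T φ S where
  minimal : ∀ S' : Set V, S' ⊆ S → IsInvariantSubtree T φ S' → S' = S

/-- The quotient of the subtree `S` by `K` has exactly one edge. -/
def IsOneEdged (T : SimpleGraph V) {K : Type*} [Group K] (φ : K →* H) (S : Set V) : Prop :=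
  (∃ a ∈ S, ∃ b ∈ S, T.Adj a b) ∧
    ∀ a ∈ S, ∀ b ∈ S, ∀ a' ∈ S, ∀ b' ∈ S, T.Adj a b → T.Adj a' b' →
      ∃ k : K, (φ k • a = a' ∧ φ k • b = b') ∨ (φ k • a = b' ∧ φ k • b = a')

/-- The edge group in `K` of the edge with endpoints `a` and `b`: its pointwise stabilizer. -/
def edgeGroup {K : Type*} [Group K] (φ : K →* H) (a b : V) : Subgroup K :=
  (MulAction.stabilizer H a ⊓ MulAction.stabilizer H b).comap φ

/-- The element `k` is hyperbolic in the splitting of `K` given by `S`: it is not conjugate into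
a vertex group. -/
def IsHyperbolicElement {K : Type*} [Group K] (φ : K →* H) (S : Set V) (k : K) : Prop :=
  ∀ a ∈ S, φ k • a ≠ a

/-- `T` is the Bass–Serre tree of a one-edged splitting of `H` with infinite cyclic edge group. -/
structure IsOneEdgedCyclicSplitting (H : Type*) [Group H] {V : Type*} [MulAction H V]
    (T : SimpleGraph V) : Prop where
  acts : ActsOnTree H T
  minimal : IsMinimalSubtree T (MonoidHom.id H) Set.univ
  oneEdged : IsOneEdged T (MonoidHom.id H) Set.univ
  cyclic : ∀ a b : V, T.Adj a b → IsCyclic (edgeGroup (MonoidHom.id H) a b)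
  infinite : ∀ a b : V, T.Adj a b → Infinite (edgeGroup (MonoidHom.id H) a b)

end Splittings

/-!
Fix an edge `e` of `S` with endpoints `a`, `b`, and an element `g` of `E i` that is hyperbolic on
`S`. Nontrivial powers in a limit group have the same centralizer as the element itself
(`IsLimitGroup.commute_of_pow_left`, a consequence of commutative transitivity), and every element
of `F i j` has a power in `E i`; hence the adjoined roots commute with `E i`
(`RootExtensionData.IsAdjunctionOfRoots.commute_fromRoot`).

*The inclusion of edge groups is proper.* Let `h` be the image in `H` of a root of `E i`. As `h`
commutes with `g`, both `S` and its translate by `h⁻¹` are `g`-invariant subtrees, and they share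
the axis of `g`, in particular an edge
(`ActsOnTree.exists_adj_mem_inter_of_forall_smul_ne`). So `h` takes some edge of `S` to an edge of
`S`; since `G` is transitive on the edges of `S`, some element of `G` does the same. If the edge
groups of `G` and `H` agreed, `h` would therefore lie in `G` (`mem_range_of_edgeGroup_le`), and so
in the centralizer of `E i`. This would hold for all roots in `F i j`, against the hypothesis.

*The index is finite.* The edge group of `H` is infinite cyclic, so it suffices that the edge group
of `G` is nontrivial. If it were trivial, the action on `S` would decompose `G` as a free product,
by a ping-pong argument on half-trees; as `G` is freely indecomposable, either `G` fixes a vertex of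
`S`, which is impossible because of `g`, or `G` is infinite cyclic
(`IsFreelyIndecomposable.exists_fixed_or_zpowers`). In the last case every element of `H` has a
power in `G` (`RootExtensionData.IsAdjunctionOfRoots.exists_pow_mem_range_of_zpowers`), so the
edge group of `H`, being torsion-free and nontrivial, meets `G` nontrivially after all.
-/

/-! ### Commutation in free groups and limit groups -/

/-- If two generators are available, one of the four letters cancels neither against the end of a
nontrivial reduced word `w` nor against its beginning, and is not its first letter; multiplying
`w` by this letter on the left and on the right gives words with different first letters. -/
theorem FreeGroup.eq_one_of_forall_commute_of {α : Type*} [Nontrivial α] {g : FreeGroup α}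
    (hg : ∀ i, Commute g (FreeGroup.of i)) : g = 1 := by
  classical
  by_contra hne
  have hw : g.toWord ≠ [] := by simpa using hne
  obtain ⟨p, L, hL⟩ := List.exists_cons_of_ne_nil hw
  obtain ⟨y, hy⟩ := exists_ne p.1
  set q := g.toWord.getLast hw with hq
  obtain ⟨ε, hε⟩ : ∃ ε : Bool, y = q.1 → q.2 = ε := ⟨q.2, fun _ => rfl⟩
  have hcomm : Commute g (FreeGroup.mk [(y, ε)]) := by
    cases ε
    · simpa [FreeGroup.of, FreeGroup.inv_mk, FreeGroup.invRev] using (hg y).inv_right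
    · exact hg y
  have hred : FreeGroup.IsReduced g.toWord := FreeGroup.isReduced_toWord
  have h1 : FreeGroup.IsReduced (g.toWord ++ [(y, ε)]) := by
    unfold FreeGroup.IsReduced at *
    rw [List.isChain_append]
    refine ⟨hred, by simp, ?_⟩
    intro a ha b hb
    rw [List.getLast?_eq_getLast_of_ne_nil hw] at ha
    simp only [Option.mem_def, Option.some.injEq, List.head?_cons] at ha hb
    subst ha hb
    exact fun h => hε h.symm
  have h2 : FreeGroup.IsReduced ((y, ε) :: g.toWord) := by
    unfold FreeGroup.IsReduced at *
    rw [hL] at hred ⊢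
    refine List.isChain_cons_cons.2 ⟨fun h => absurd h hy, hred⟩
  have h3 : (g * FreeGroup.mk [(y, ε)]).toWord = g.toWord ++ [(y, ε)] := by
    conv_lhs => rw [← FreeGroup.mk_toWord (x := g)]
    rw [FreeGroup.mul_mk, FreeGroup.toWord_mk, h1.reduce_eq]
  have h4 : (FreeGroup.mk [(y, ε)] * g).toWord = (y, ε) :: g.toWord := by
    conv_lhs => rw [← FreeGroup.mk_toWord (x := g)]
    rw [FreeGroup.mul_mk, FreeGroup.toWord_mk, List.singleton_append, h2.reduce_eq]
  rw [hcomm.eq, h4, hL] at h3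
  simp only [List.cons_append, List.cons.injEq] at h3
  exact hy (congrArg Prod.fst h3.1)

theorem FreeGroup.commute_of_subsingleton {α : Type*} [Subsingleton α] (g h : FreeGroup α) :
    Commute g h := by
  rcases isEmpty_or_nonempty α with _ | ⟨⟨a⟩⟩
  · exact Subsingleton.elim _ _
  · let _ : Unique α := { default := a, uniq := fun b => Subsingleton.elim b a }
    let _ := IsCyclic.commGroup (α := FreeGroup α)
    exact mul_comm g h

/-- Free groups are commutative transitive: the centralizer of `y` is free by Nielsen–Schreier and
has the nontrivial central element `y`, so it has rank at most one. -/
theorem FreeGroup.commute_trans {α : Type*} {g y h : FreeGroup α} (hy : y ≠ 1)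
    (hg : Commute g y) (hh : Commute y h) : Commute g h := by
  let C := Subgroup.centralizer {y}
  have mem : ∀ z, Commute z y → z ∈ C := fun z hz =>
    Subgroup.mem_centralizer_singleton_iff.2 hz.eq
  let e := IsFreeGroup.toFreeGroup C
  have hsub : Subsingleton (IsFreeGroup.Generators C) := by
    by_contra hns
    have := not_subsingleton_iff_nontrivial.1 hns
    have h1 : e ⟨y, mem y rfl⟩ = 1 := by
      refine FreeGroup.eq_one_of_forall_commute_of fun i => ?_
      obtain ⟨z, hz⟩ := e.surjective (FreeGroup.of i)
      rw [← hz]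
      refine Commute.map (Subtype.ext ?_) e
      exact (Subgroup.mem_centralizer_singleton_iff.1 z.2).symm
    rw [map_eq_one_iff e e.injective] at h1
    exact hy (congrArg Subtype.val h1)
  have := (FreeGroup.commute_of_subsingleton (e ⟨g, mem g hg⟩) (e ⟨h, mem h hh.symm⟩)).eq
  rw [← _root_.map_mul, ← _root_.map_mul] at this
  exact congrArg Subtype.val (e.injective this)

namespace IsLimitGroup

variable {G : Type u} [Group G]

theorem eq_one_of_pow_eq_one (hG : IsLimitGroup G) {g : G} {n : ℕ} (hn : n ≠ 0) (h : g ^ n = 1) :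
    g = 1 := by
  classical
  obtain ⟨m, f, hf⟩ := hG.2 {1, g}
  refine hf (by simp) (by simp) ?_
  rw [map_one]
  have : f g ^ n = 1 := by rw [← map_pow, h, map_one]
  exact (pow_eq_one_iff_left hn).1 this

theorem commute_trans (hG : IsLimitGroup G) {g y h : G} (hy : y ≠ 1)
    (hg : Commute g y) (hh : Commute y h) : Commute g h := by
  classical
  obtain ⟨m, f, hf⟩ := hG.2 {1, y, g * h, h * g}
  refine hf (by simp) (by simp) ?_
  have hfy : f y ≠ 1 := fun h1 => hy (hf (by simp) (by simp) (h1.trans (map_one f).symm))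
  rw [map_mul, map_mul]
  exact FreeGroup.commute_trans hfy (hg.map f) (hh.map f)

/-- An element of a limit group commutes with everything that one of its powers commutes with:
by commutative transitivity, applied to this power. -/
theorem commute_of_pow_left (hG : IsLimitGroup G) {g h : G} {n : ℕ} (hn : n ≠ 0)
    (hc : Commute (g ^ n) h) : Commute g h := by
  by_cases h1 : g = 1
  · rw [h1]; exact Commute.one_left h
  · exact hG.commute_trans (fun h2 => h1 (hG.eq_one_of_pow_eq_one hn h2)) (Commute.self_pow g n) hc

theorem infinite_subgroup (hG : IsLimitGroup G) {A : Subgroup G} (hA : A ≠ ⊥) : Infinite A := by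
  obtain ⟨a, ha1⟩ := A.ne_bot_iff_exists_ne_one.1 hA
  by_contra hfin
  rw [not_infinite_iff_finite] at hfin
  obtain ⟨n, hn, h⟩ := isOfFinOrder_iff_pow_eq_one.1 (isOfFinOrder_of_finite a)
  refine ha1 (Subtype.ext (hG.eq_one_of_pow_eq_one hn.ne' ?_))
  exact congrArg Subtype.val h

end IsLimitGroup

/-! ### Half-trees -/

namespace SimpleGraph

variable {V : Type*} {T : SimpleGraph V}

/-- The vertices of `T` that are closer to `b` than to `a`. If `T` is a tree and `a`, `b` are
adjacent, this is the component of `b` after removal of the edge from `a` to `b`. -/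
def halfTree (T : SimpleGraph V) (a b : V) : Set V := {v | T.dist v b < T.dist v a}

theorem mem_halfTree {a b v : V} : v ∈ T.halfTree a b ↔ T.dist v b < T.dist v a := Iff.rfl

theorem left_notMem_halfTree (a b : V) : a ∉ T.halfTree a b := by simp [mem_halfTree]

theorem Adj.right_mem_halfTree {a b : V} (h : T.Adj a b) : b ∈ T.halfTree a b := by
  simp [mem_halfTree, dist_eq_one_iff_adj.2 h.symm]

theorem IsTree.mem_halfTree_iff_dist (hT : T.IsTree) {a b v : V} (h : T.Adj a b) :
    v ∈ T.halfTree a b ↔ T.dist v a = T.dist v b + 1 := by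
  have := hT.dist_eq_dist_add_one_of_adj v h
  rw [mem_halfTree]; omega

theorem IsTree.notMem_halfTree_iff (hT : T.IsTree) {a b v : V} (h : T.Adj a b) :
    v ∉ T.halfTree a b ↔ v ∈ T.halfTree b a := by
  have := hT.dist_ne_of_adj v h
  rw [mem_halfTree, mem_halfTree]; omega

theorem IsTree.eq_of_mem_halfTree (hT : T.IsTree) {a b c v : V} (hb : T.Adj a b)
    (hc : T.Adj a c) (hvb : v ∈ T.halfTree a b) (hvc : v ∈ T.halfTree a c) : b = c := by
  classical
  obtain ⟨p, hp, -⟩ := hT.connected.exists_path_of_dist v a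
  -- a neighbour of `a` that is closer to `v` lies on the path from `v` to `a`
  have key : ∀ {d}, T.Adj a d → v ∈ T.halfTree a d → d = p.penultimate := by
    intro d hd hvd
    refine hT.isAcyclic.eq_penultimate_of_adj_end hp hd ?_
    obtain ⟨q, hq, hql⟩ := hT.connected.exists_path_of_dist v d
    refine hT.isAcyclic.mem_support_of_ne_mem_support_of_adj_of_isPath hp hq hd fun ha => ?_
    have h1 := dist_le (q.takeUntil a ha)
    have h2 := q.length_takeUntil_le_length ha
    rw [mem_halfTree] at hvd
    omega
  rw [key hb hvb, key hc hvc]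

theorem IsTree.disjoint_halfTree (hT : T.IsTree) {a b c : V} (hb : T.Adj a b) (hc : T.Adj a c)
    (hbc : b ≠ c) : Disjoint (T.halfTree a b) (T.halfTree a c) :=
  Set.disjoint_left.2 fun _ h h' => hbc (hT.eq_of_mem_halfTree hb hc h h')

theorem Connected.exists_adj_mem_halfTree (hT : T.Connected) {a v : V} (h : a ≠ v) :
    ∃ b, T.Adj a b ∧ v ∈ T.halfTree a b := by
  obtain ⟨p, hp⟩ := hT.exists_walk_length_eq_dist a v
  cases p with
  | nil => exact absurd rfl h
  | cons hb q =>
    refine ⟨_, hb, ?_⟩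
    have := dist_le q
    rw [mem_halfTree, dist_comm, T.dist_comm (u := v)]
    simp only [Walk.length_cons] at hp
    omega

/-- The edge from `a` to `b` is the only edge entering the half-tree at `b`. -/
theorem IsTree.eq_of_adj_of_mem_halfTree (hT : T.IsTree) {a b x y : V} (h : T.Adj a b)
    (hxy : T.Adj x y) (hx : x ∉ T.halfTree a b) (hy : y ∈ T.halfTree a b) : x = a ∧ y = b := by
  rw [hT.notMem_halfTree_iff h, hT.mem_halfTree_iff_dist h.symm] at hx
  have hy' := hy
  rw [hT.mem_halfTree_iff_dist h] at hy'
  have h1 : T.dist y a ≤ 1 + T.dist x a := by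
    have := hT.connected.dist_triangle (u := y) (v := x) (w := a)
    rwa [dist_eq_one_iff_adj.2 hxy.symm] at this
  have h2 : T.dist x b ≤ 1 + T.dist y b := by
    have := hT.connected.dist_triangle (u := x) (v := y) (w := b)
    rwa [dist_eq_one_iff_adj.2 hxy] at this
  by_cases hxa : a = x
  · subst hxa
    refine ⟨rfl, ?_⟩
    simp only [dist_self] at hx h1
    exact hT.connected.dist_eq_zero_iff.1 (by omega)
  · -- the neighbour `c` of `a` towards `x` is also closer to `y`, so it would be `b`
    obtain ⟨c, hc, hxc⟩ := hT.connected.exists_adj_mem_halfTree hxa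
    have hyc : y ∈ T.halfTree a c := by
      rw [mem_halfTree] at hxc ⊢
      have := hT.connected.dist_triangle (u := y) (v := x) (w := c)
      rw [dist_eq_one_iff_adj.2 hxy.symm] at this
      omega
    have := hT.eq_of_mem_halfTree h hc hy hyc
    subst this
    rw [mem_halfTree] at hxc
    omega

/-- A walk that enters the half-tree at `b` passes through the edge from `a` to `b`. -/
theorem IsTree.le_length_of_mem_halfTree (hT : T.IsTree) {a b : V} (h : T.Adj a b) {x y : V}
    (p : T.Walk x y) (hx : x ∉ T.halfTree a b) (hy : y ∈ T.halfTree a b) :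
    T.dist x a + 1 + T.dist b y ≤ p.length := by
  induction p with
  | nil => exact absurd hy hx
  | @cons x z y hxz q ih =>
    rw [Walk.length_cons]
    by_cases hz : z ∈ T.halfTree a b
    · obtain ⟨rfl, rfl⟩ := hT.eq_of_adj_of_mem_halfTree h hxz hx hz
      have := dist_le q
      rw [dist_self]; omega
    · have h1 := ih hz hy
      have := hT.connected.dist_triangle (u := x) (v := z) (w := a)
      rw [dist_eq_one_iff_adj.2 hxz] at this
      omega

/-- The edge from `a` to `b` separates its two half-trees. -/
theorem IsTree.dist_eq_of_mem_halfTree (hT : T.IsTree) {a b : V} (h : T.Adj a b) {x y : V}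
    (hx : x ∉ T.halfTree a b) (hy : y ∈ T.halfTree a b) :
    T.dist x y = T.dist x a + T.dist a y := by
  obtain ⟨p, hp⟩ := hT.connected.exists_walk_length_eq_dist x y
  have h1 := hT.le_length_of_mem_halfTree h p hx hy
  have h2 := hT.connected.dist_triangle (u := x) (v := a) (w := y)
  rw [hT.mem_halfTree_iff_dist h, dist_comm, T.dist_comm (u := y)] at hy
  omega

/-! ### Subtrees -/

theorem Connected.induce_induction {S : Set V} (hS : (T.induce S).Connected) {P : V → Prop}
    {x : V} (hx : x ∈ S) (h0 : P x)
    (hP : ∀ u ∈ S, ∀ v ∈ S, T.Adj u v → P u → P v) : ∀ y ∈ S, P y := by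
  intro y hy
  obtain ⟨p⟩ := hS.preconnected ⟨x, hx⟩ ⟨y, hy⟩
  suffices ∀ {u v : S}, (T.induce S).Walk u v → P u → P v from this p h0
  intro u v q
  induction q with
  | nil => exact id
  | @cons u w _ huw _ ih => exact fun hu => ih (hP u u.2 w w.2 huw hu)

/-- A subtree that does not contain the edge from `a` to `b` lies on one side of it. -/
theorem IsTree.mem_halfTree_of_connected (hT : T.IsTree) {S : Set V}
    (hS : (T.induce S).Connected) {a b x y : V} (h : T.Adj a b) (hab : ¬ (a ∈ S ∧ b ∈ S))
    (hx : x ∈ S) (hy : y ∈ S) (hxH : x ∈ T.halfTree a b) : y ∈ T.halfTree a b := by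
  refine hS.induce_induction (P := (· ∈ T.halfTree a b)) hx hxH ?_ y hy
  intro u hu v hv huv huH
  by_contra hvH
  obtain ⟨rfl, rfl⟩ := hT.eq_of_adj_of_mem_halfTree h huv.symm hvH huH
  exact hab ⟨hv, hu⟩

end SimpleGraph

/-! ### Group actions on trees -/

namespace ActsOnTree

open SimpleGraph

variable {K : Type*} [Group K] {V : Type*} [MulAction K V] {T : SimpleGraph V}

theorem dist_smul (hK : ActsOnTree K T) (k : K) (a b : V) :
    T.dist (k • a) (k • b) = T.dist a b := by
  have key : ∀ (k : K) (a b : V), T.dist (k • a) (k • b) ≤ T.dist a b := by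
    intro k a b
    obtain ⟨p, hp⟩ := hK.isTree.connected.exists_walk_length_eq_dist a b
    let f : T →g T := ⟨fun v => k • v, fun {a b} h => hK.adj_smul k a b h⟩
    have := dist_le (p.map f)
    rw [Walk.length_map, hp] at this
    exact this
  refine le_antisymm (key k a b) ?_
  simpa using key k⁻¹ (k • a) (k • b)

theorem smul_mem_halfTree (hK : ActsOnTree K T) (k : K) {a b v : V}
    (h : v ∈ T.halfTree a b) : k • v ∈ T.halfTree (k • a) (k • b) := by
  rwa [mem_halfTree, hK.dist_smul, hK.dist_smul]

theorem connected_induce_image_smul (hK : ActsOnTree K T) {S : Set V}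
    (hS : (T.induce S).Connected) (k : K) : (T.induce ((fun v => k • v) '' S)).Connected := by
  let f : T →g T := ⟨fun v => k • v, fun {a b} h => hK.adj_smul k a b h⟩
  refine hS.map (induceHom f (Set.mapsTo_image f S)) ?_
  rintro ⟨_, v, hv, rfl⟩
  exact ⟨⟨v, hv⟩, rfl⟩

/-- If disjoint subtrees were joined by a bridge, an automorphism preserving both subtrees would
fix the endpoints of the bridge. -/
theorem inter_nonempty_of_forall_smul_ne (hK : ActsOnTree K T) {S S' : Set V}
    (hS : (T.induce S).Connected) (hS' : (T.induce S').Connected) {g : K}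
    (hgS : ∀ a ∈ S, g • a ∈ S) (hgS1 : ∀ a ∈ S, g⁻¹ • a ∈ S) (hgS' : ∀ a ∈ S', g • a ∈ S')
    (hg : ∀ a ∈ S, g • a ≠ a) : (S ∩ S').Nonempty := by
  classical
  have hT := hK.isTree
  by_contra hdisj
  have hdis : ∀ a ∈ S, a ∉ S' := fun a ha ha' => hdisj ⟨a, ha, ha'⟩
  obtain ⟨⟨x₀, hx₀⟩⟩ := hS.nonempty
  obtain ⟨⟨y₀, hy₀⟩⟩ := hS'.nonempty
  have hex : ∃ n, ∃ u ∈ S, ∃ v ∈ S', T.dist u v = n := ⟨_, x₀, hx₀, y₀, hy₀, rfl⟩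
  obtain ⟨u, hu, v, hv, huv⟩ := Nat.find_spec hex
  have hmin : ∀ u' ∈ S, T.dist u v ≤ T.dist u' v := fun u' hu' =>
    huv ▸ Nat.find_min' hex ⟨u', hu', v, hv, rfl⟩
  have huv' : u ≠ v := fun h => hdis u hu (h ▸ hv)
  obtain ⟨w, huw, hvw⟩ := hT.connected.exists_adj_mem_halfTree huv'
  have hwS : w ∉ S := fun hw => by
    have := hmin w hw
    rw [mem_halfTree, dist_comm, T.dist_comm (u := v)] at hvw
    omega
  have hgw : g • w ∉ S := fun h => hwS (by simpa using hgS1 _ h)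
  have hguw := hK.adj_smul g u w huw
  -- the half-trees at `w` and at `g • w` both contain `v` and avoid `S`
  have hv' : v ∈ T.halfTree (g • u) (g • w) :=
    hT.mem_halfTree_of_connected hS' hguw (fun h => hdis _ (hgS u hu) h.1) (hgS' v hv) hv
      (hK.smul_mem_halfTree g hvw)
  have h1 : g • u ∉ T.halfTree u w := fun h => left_notMem_halfTree u w
    (hT.mem_halfTree_of_connected hS huw (fun h => hwS h.2) (hgS u hu) hu h)
  have h2 : u ∉ T.halfTree (g • u) (g • w) := fun h => left_notMem_halfTree _ _
    (hT.mem_halfTree_of_connected hS hguw (fun h => hgw h.2) hu (hgS u hu) h)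
  have e1 := hT.dist_eq_of_mem_halfTree huw h1 hvw
  have e2 := hT.dist_eq_of_mem_halfTree hguw h2 hv'
  exact hg u hu (hT.connected.dist_eq_zero_iff.1 (by omega))

/-- The intersection of two subtrees invariant under the hyperbolic element `g` contains the axis
of `g`, hence an edge. -/
theorem exists_adj_mem_inter_of_forall_smul_ne (hK : ActsOnTree K T) {S S' : Set V}
    (hS : (T.induce S).Connected) (hS' : (T.induce S').Connected) {g : K}
    (hgS : ∀ a ∈ S, g • a ∈ S) (hgS1 : ∀ a ∈ S, g⁻¹ • a ∈ S) (hgS' : ∀ a ∈ S', g • a ∈ S')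
    (hg : ∀ a ∈ S, g • a ≠ a) : ∃ a ∈ S ∩ S', ∃ b ∈ S ∩ S', T.Adj a b := by
  obtain ⟨u, hu, hu'⟩ := hK.inter_nonempty_of_forall_smul_ne hS hS' hgS hgS1 hgS' hg
  obtain ⟨w, huw, hgu⟩ := hK.isTree.connected.exists_adj_mem_halfTree (hg u hu).symm
  have key : ∀ {R : Set V}, (T.induce R).Connected → u ∈ R → g • u ∈ R → w ∈ R := by
    intro R hR h1 h2
    by_contra hw
    exact left_notMem_halfTree u w
      (hK.isTree.mem_halfTree_of_connected hR huw (fun h => hw h.2) h2 h1 hgu)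
  exact ⟨u, ⟨hu, hu'⟩, w, ⟨key hS hu (hgS u hu), key hS' hu' (hgS' u hu')⟩, huw⟩

end ActsOnTree

/-! ### Free splittings from actions with trivial edge stabilizers -/

open Function in
/-- The ping-pong lemma for two subgroups. -/
theorem Monoid.Coprod.lift_subtype_injective_of_ping_pong {K : Type*} [Group K] {α : Type*}
    [MulAction K α] (A B : Subgroup K) [Infinite A] {X Y : Set α} (hX : X.Nonempty)
    (hY : Y.Nonempty) (hXY : Disjoint X Y)
    (hA : ∀ k ∈ A, k ≠ 1 → ∀ y ∈ Y, k • y ∈ X) (hB : ∀ k ∈ B, k ≠ 1 → ∀ x ∈ X, k • x ∈ Y) :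
    Injective (Monoid.Coprod.lift A.subtype B.subtype) := by
  let C : Bool → Subgroup K := fun i => bif i then A else B
  let f : ∀ i, C i →* K := fun i => (C i).subtype
  have hf : Injective (Monoid.CoprodI.lift f) := by
    refine Monoid.CoprodI.lift_injective_of_ping_pong f (Or.inr ⟨true, ?_⟩)
      (fun i => bif i then X else Y) ?_ ?_ ?_
    · have : Infinite (C true) := ‹Infinite A›
      exact (Cardinal.natCast_lt_aleph0 (n := 3)).le.trans (Cardinal.infinite_iff.1 this)
    · rintro (_ | _)
      exacts [hY, hX]
    · rintro (_ | _) (_ | _) h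
      exacts [absurd rfl h, hXY.symm, hXY, absurd rfl h]
    · rintro (_ | _) (_ | _) h k hk _ ⟨x, hx, rfl⟩
      · exact absurd rfl h
      · exact hB k k.2 (fun h => hk (Subtype.ext h)) x hx
      · exact hA k k.2 (fun h => hk (Subtype.ext h)) x hx
      · exact absurd rfl h
  -- the binary free product embeds in the free product over `Bool`
  let ψ : Monoid.Coprod A B →* Monoid.CoprodI (fun i => C i) :=
    Monoid.Coprod.lift (Monoid.CoprodI.of (M := fun i => C i) (i := true))
      (Monoid.CoprodI.of (M := fun i => C i) (i := false))
  let g : ∀ i, C i →* Monoid.Coprod A B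
    | true => (Monoid.Coprod.inl : A →* Monoid.Coprod A B)
    | false => (Monoid.Coprod.inr : B →* Monoid.Coprod A B)
  let χ : Monoid.CoprodI (fun i => C i) →* Monoid.Coprod A B := Monoid.CoprodI.lift g
  have hχ : χ.comp ψ = MonoidHom.id _ := by
    refine Monoid.Coprod.hom_ext ?_ ?_ <;> ext k
    · exact Monoid.CoprodI.lift_of (M := fun i => C i) (i := true) g k
    · exact Monoid.CoprodI.lift_of (M := fun i => C i) (i := false) g k
  have hψ : Injective ψ :=
    LeftInverse.injective (g := χ) fun k => DFunLike.congr_fun hχ k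
  have hlift : Monoid.Coprod.lift A.subtype B.subtype = (Monoid.CoprodI.lift f).comp ψ := by
    refine Monoid.Coprod.hom_ext ?_ ?_ <;> ext k
    · exact (Monoid.CoprodI.lift_of (M := fun i => C i) (i := true) f k).symm
    · exact (Monoid.CoprodI.lift_of (M := fun i => C i) (i := false) f k).symm
  rw [hlift]
  exact hf.comp hψ

theorem Monoid.Coprod.lift_subtype_surjective {K : Type*} [Group K] {A B : Subgroup K}
    (h : A ⊔ B = ⊤) : Function.Surjective (Monoid.Coprod.lift A.subtype B.subtype) := by
  rw [← MonoidHom.range_eq_top, Monoid.Coprod.range_lift, A.range_subtype, B.range_subtype, h]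

namespace ActsOnTree

open SimpleGraph MulAction

variable {K : Type*} [Group K] {V : Type*} [MulAction K V] {T : SimpleGraph V}

/-- If every vertex of the subtree `S` adjacent to a translate of `a` or `b` under the subgroup `L`
is itself such a translate, then these translates exhaust `S`. -/
theorem exists_smul_eq_of_forall_adj {S : Set V} (hS : (T.induce S).Connected)
    {a b : V} (haS : a ∈ S) (L : Subgroup K)
    (hL : ∀ l ∈ L, ∀ c ∈ S, T.Adj (l • a) c → ∃ m ∈ L, m • a = c ∨ m • b = c)
    (hL' : ∀ l ∈ L, ∀ c ∈ S, T.Adj (l • b) c → ∃ m ∈ L, m • a = c ∨ m • b = c) :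
    ∀ c ∈ S, ∃ m ∈ L, m • a = c ∨ m • b = c := by
  refine hS.induce_induction haS ⟨1, L.one_mem, Or.inl (one_smul K a)⟩ ?_
  rintro u hu c hc huc ⟨l, hl, rfl | rfl⟩
  exacts [hL l hl c hc huc, hL' l hl c hc huc]

/-- The amalgamated case: with trivial edge stabilizer, `K` is the free product of the stabilizers
of the endpoints of an edge, if these are in different orbits. Generation holds without the
hypothesis `hinf`, which makes the ping-pong lemma applicable. -/
theorem sup_eq_top_and_bijective_lift_stabilizer (hK : ActsOnTree K T) {S : Set V}
    (hS : IsInvariantSubtree T (MonoidHom.id K) S) (hS1 : IsOneEdged T (MonoidHom.id K) S)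
    {a b : V} (ha : a ∈ S) (hb : b ∈ S) (hab : T.Adj a b)
    (htriv : ∀ k : K, k • a = a → k • b = b → k = 1) (hne : ∀ k : K, k • a ≠ b)
    (hinf : stabilizer K a ≠ ⊥ → Infinite (stabilizer K a)) :
    stabilizer K a ⊔ stabilizer K b = ⊤ ∧ (stabilizer K a ≠ ⊥ → Function.Bijective
      (Monoid.Coprod.lift (stabilizer K a).subtype (stabilizer K b).subtype)) := by
  have hT := hK.isTree
  have hsup : stabilizer K a ⊔ stabilizer K b = ⊤ := by
    refine top_unique fun g _ => ?_
    set L := stabilizer K a ⊔ stabilizer K b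
    have hLa : ∀ k : K, k • a = a → k ∈ L := fun k hk =>
      Subgroup.mem_sup_left (mem_stabilizer_iff.2 hk)
    have hLb : ∀ k : K, k • b = b → k ∈ L := fun k hk =>
      Subgroup.mem_sup_right (mem_stabilizer_iff.2 hk)
    have key : ∀ c ∈ S, ∃ m ∈ L, m • a = c ∨ m • b = c := by
      refine exists_smul_eq_of_forall_adj hS.connected ha L ?_ ?_
      · intro l hl c hc hlc
        obtain ⟨k, ⟨h1, h2⟩ | ⟨h1, h2⟩⟩ :=
          hS1.2 a ha b hb (l • a) (hS.invariant l a ha) c hc hab hlc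
        · simp only [MonoidHom.id_apply] at h1 h2
          have := L.mul_mem hl (hLa (l⁻¹ * k) (by rw [mul_smul, h1, inv_smul_smul]))
          exact ⟨k, by simpa using this, Or.inr h2⟩
        · simp only [MonoidHom.id_apply] at h1 h2
          exact absurd (by rw [mul_smul, ← h2, inv_smul_smul]) (hne (k⁻¹ * l))
      · intro l hl c hc hlc
        obtain ⟨k, ⟨h1, h2⟩ | ⟨h1, h2⟩⟩ :=
          hS1.2 a ha b hb (l • b) (hS.invariant l b hb) c hc hab hlc
        · simp only [MonoidHom.id_apply] at h1 h2
          exact absurd (by rw [mul_smul, h1, inv_smul_smul]) (hne (l⁻¹ * k))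
        · simp only [MonoidHom.id_apply] at h1 h2
          have := L.mul_mem hl (hLb (l⁻¹ * k) (by rw [mul_smul, h2, inv_smul_smul]))
          exact ⟨k, by simpa using this, Or.inl h1⟩
    obtain ⟨m, hm, h | h⟩ := key (g • a) (hS.invariant g a ha)
    · have := L.mul_mem hm (hLa (m⁻¹ * g) (by rw [mul_smul, ← h, inv_smul_smul]))
      simpa using this
    · exact absurd (by rw [mul_smul, ← h, inv_smul_smul]) (hne (m⁻¹ * g))
  refine ⟨hsup, fun hbot => ⟨?_, Monoid.Coprod.lift_subtype_surjective hsup⟩⟩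
  have := hinf hbot
  -- the two half-trees of the edge are the ping-pong table
  refine Monoid.Coprod.lift_subtype_injective_of_ping_pong _ _ (α := V)
    (X := T.halfTree b a) (Y := T.halfTree a b) ⟨a, hab.symm.right_mem_halfTree⟩
    ⟨b, hab.right_mem_halfTree⟩ ?_ ?_ ?_
  · exact Set.disjoint_left.2 fun x h h' => (hT.notMem_halfTree_iff hab).2 h h'
  · intro k hk hk1 y hy
    rw [mem_stabilizer_iff] at hk
    have h1 := hK.smul_mem_halfTree k hy
    have h2 := hK.adj_smul k a b hab
    rw [hk] at h1 h2
    rw [← hT.notMem_halfTree_iff hab]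
    exact Set.disjoint_left.1 (hT.disjoint_halfTree h2 hab fun h => hk1 (htriv k hk h)) h1
  · intro k hk hk1 y hy
    rw [mem_stabilizer_iff] at hk
    have h1 := hK.smul_mem_halfTree k hy
    have h2 := hK.adj_smul k b a hab.symm
    rw [hk] at h1 h2
    rw [← hT.notMem_halfTree_iff hab.symm]
    exact Set.disjoint_left.1
      (hT.disjoint_halfTree h2 hab.symm fun h => hk1 (htriv k h hk)) h1

/-- The HNN case: with trivial edge stabilizer, `K` is the free product of the stabilizer of an
endpoint of an edge and of an infinite cyclic group, if an element `t` moves this endpoint to the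
other one. -/
theorem sup_eq_top_and_bijective_lift_zpowers (hK : ActsOnTree K T) {S : Set V}
    (hS : IsInvariantSubtree T (MonoidHom.id K) S) (hS1 : IsOneEdged T (MonoidHom.id K) S)
    {a : V} {t : K} (ha : a ∈ S) (hab : T.Adj a (t • a))
    (htriv : ∀ k : K, k • a = a → k • t • a = t • a → k = 1)
    (hinf : stabilizer K a ≠ ⊥ → Infinite (stabilizer K a)) :
    stabilizer K a ⊔ Subgroup.zpowers t = ⊤ ∧ (stabilizer K a ≠ ⊥ → Function.Bijective
      (Monoid.Coprod.lift (stabilizer K a).subtype (Subgroup.zpowers t).subtype)) := by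
  have hT := hK.isTree
  have hsup : stabilizer K a ⊔ Subgroup.zpowers t = ⊤ := by
    refine top_unique fun g _ => ?_
    set L := stabilizer K a ⊔ Subgroup.zpowers t
    have hLa : ∀ k : K, k • a = a → k ∈ L := fun k hk =>
      Subgroup.mem_sup_left (mem_stabilizer_iff.2 hk)
    have htL : t ∈ L := Subgroup.mem_sup_right (Subgroup.mem_zpowers t)
    have hLt : ∀ l ∈ L, ∀ c ∈ S, T.Adj (l • a) c → ∃ m ∈ L, m • a = c ∨ m • a = c := by
      intro l hl c hc hlc
      have htS := hS.invariant t a ha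
      obtain ⟨k, ⟨h1, h2⟩ | ⟨h1, h2⟩⟩ :=
        hS1.2 a ha _ htS (l • a) (hS.invariant l a ha) c hc hab hlc
      · simp only [MonoidHom.id_apply] at h1 h2
        have := L.mul_mem hl (hLa (l⁻¹ * k) (by rw [mul_smul, h1, inv_smul_smul]))
        rw [mul_inv_cancel_left] at this
        exact ⟨k * t, L.mul_mem this htL, Or.inl (by rw [mul_smul, h2])⟩
      · simp only [MonoidHom.id_apply] at h1 h2
        have := L.mul_mem hl (hLa (l⁻¹ * (k * t)) (by
          rw [mul_smul, mul_smul, h2, inv_smul_smul]))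
        rw [mul_inv_cancel_left] at this
        exact ⟨k, by simpa using L.mul_mem this (L.inv_mem htL), Or.inl h1⟩
    obtain ⟨m, hm, h⟩ := exists_smul_eq_of_forall_adj hS.connected ha L hLt hLt
      (g • a) (hS.invariant g a ha)
    rw [or_self] at h
    have := L.mul_mem hm (hLa (m⁻¹ * g) (by rw [mul_smul, ← h, inv_smul_smul]))
    simpa using this
  refine ⟨hsup, fun hbot => ⟨?_, Monoid.Coprod.lift_subtype_surjective hsup⟩⟩
  have := hinf hbot
  have hab' : T.Adj a (t⁻¹ • a) := by
    have := (hK.adj_smul t⁻¹ a (t • a) hab).symm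
    rwa [inv_smul_smul] at this
  have htt : t • a ≠ t⁻¹ • a := fun h =>
    hK.no_inversion t a (t • a) hab ⟨rfl, by rw [h, smul_inv_smul]⟩
  -- the half-trees at the two neighbours of `a` on the axis of `t`
  have hdis := hT.disjoint_halfTree hab hab' htt
  have hstep : ∀ v ∉ T.halfTree a (t⁻¹ • a), t • v ∈ T.halfTree a (t • a) := by
    intro v hv
    have := hK.smul_mem_halfTree t ((hT.notMem_halfTree_iff hab').1 hv)
    rwa [smul_inv_smul] at this
  have hstep' : ∀ v ∉ T.halfTree a (t • a), t⁻¹ • v ∈ T.halfTree a (t⁻¹ • a) := by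
    intro v hv
    have := hK.smul_mem_halfTree t⁻¹ ((hT.notMem_halfTree_iff hab).1 hv)
    rwa [inv_smul_smul] at this
  have hpow : ∀ (n : ℕ), ∀ v ∉ T.halfTree a (t⁻¹ • a),
      t ^ (n + 1) • v ∈ T.halfTree a (t • a) := by
    intro n v hv
    induction n with
    | zero => simpa using hstep v hv
    | succ n ih =>
      rw [pow_succ', mul_smul]
      exact hstep _ (Set.disjoint_left.1 hdis ih)
  have hpow' : ∀ (n : ℕ), ∀ v ∉ T.halfTree a (t • a),
      t⁻¹ ^ (n + 1) • v ∈ T.halfTree a (t⁻¹ • a) := by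
    intro n v hv
    induction n with
    | zero => simpa using hstep' v hv
    | succ n ih =>
      rw [pow_succ', mul_smul]
      exact hstep' _ (Set.disjoint_right.1 hdis ih)
  refine Monoid.Coprod.lift_subtype_injective_of_ping_pong _ _ (α := V)
    (X := (T.halfTree a (t • a) ∪ T.halfTree a (t⁻¹ • a))ᶜ)
    (Y := T.halfTree a (t • a) ∪ T.halfTree a (t⁻¹ • a)) ⟨a, ?_⟩
    ⟨t • a, Or.inl hab.right_mem_halfTree⟩ disjoint_compl_left ?_ ?_
  · rintro (h | h) <;> exact left_notMem_halfTree _ _ h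
  · intro k hk hk1 y hy
    rw [mem_stabilizer_iff] at hk
    -- `k` takes an edge of the axis of `t` at `a` to an edge off this axis: it fixes neither
    -- of the two edges, and exchanging them would produce an inversion
    have h1 : k • t • a ≠ t • a := fun h => hk1 (htriv k hk h)
    have h2 : k • t • a ≠ t⁻¹ • a := fun h =>
      hK.no_inversion (t * k) a (t • a) hab
        ⟨by rw [mul_smul, hk], by rw [mul_smul, h, smul_inv_smul]⟩
    have h3 : k • t⁻¹ • a ≠ t • a := fun h =>
      hK.no_inversion (t⁻¹ * k) a (t⁻¹ • a) hab'
        ⟨by rw [mul_smul, hk], by rw [mul_smul, h, inv_smul_smul]⟩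
    have h4 : k • t⁻¹ • a ≠ t⁻¹ • a := by
      intro h
      have h5 : t * k * t⁻¹ = 1 := by
        refine htriv _ ?_ ?_
        · rw [mul_smul, mul_smul, h, smul_inv_smul]
        · rw [mul_smul, mul_smul, inv_smul_smul, hk]
      exact hk1 (by simpa using h5)
    have off : ∀ c, T.Adj a c → k • c ≠ t • a → k • c ≠ t⁻¹ • a → y ∈ T.halfTree a c →
        k • y ∈ (T.halfTree a (t • a) ∪ T.halfTree a (t⁻¹ • a))ᶜ := by
      intro c hc hc1 hc2 hyc
      have hy' := hK.smul_mem_halfTree k hyc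
      have hc' := hK.adj_smul k a c hc
      rw [hk] at hy' hc'
      rintro (h | h)
      · exact hc1 (hT.eq_of_mem_halfTree hc' hab hy' h)
      · exact hc2 (hT.eq_of_mem_halfTree hc' hab' hy' h)
    rcases hy with hy | hy
    · exact off _ hab h1 h2 hy
    · exact off _ hab' h3 h4 hy
  · rintro _ ⟨n, rfl⟩ hn x hx
    simp only [Set.mem_compl_iff, Set.mem_union, not_or] at hx
    simp only at hn ⊢
    rcases n with (_ | n) | n
    · exact absurd (by simp) hn
    · left
      have := hpow n x hx.2
      rwa [← zpow_natCast] at this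
    · right
      have := hpow' n x hx.1
      rwa [inv_pow, ← zpow_negSucc] at this

end ActsOnTree

/-- A freely indecomposable limit group acting with one orbit of edges on a tree, such that edge
stabilizers are trivial, fixes a vertex or is infinite cyclic. -/
theorem IsFreelyIndecomposable.exists_fixed_or_zpowers {K : Type*} [Group K]
    (hind : IsFreelyIndecomposable K) (hlim : IsLimitGroup K) {V : Type*} [MulAction K V]
    {T : SimpleGraph V} (hK : ActsOnTree K T) {S : Set V}
    (hS : IsInvariantSubtree T (MonoidHom.id K) S) (hS1 : IsOneEdged T (MonoidHom.id K) S)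
    {a b : V} (ha : a ∈ S) (hb : b ∈ S) (hab : T.Adj a b)
    (htriv : ∀ k : K, k • a = a → k • b = b → k = 1) :
    (∃ c ∈ S, ∀ k : K, k • c = c) ∨ ∃ t : K, Subgroup.zpowers t = ⊤ := by
  by_cases hne : ∀ k : K, k • a ≠ b
  · left
    obtain ⟨hsup, hbij⟩ :=
      hK.sup_eq_top_and_bijective_lift_stabilizer hS hS1 ha hb hab htriv hne hlim.infinite_subgroup
    by_cases hA : MulAction.stabilizer K a = ⊥
    · rw [hA, bot_sup_eq] at hsup
      exact ⟨b, hb, fun k => MulAction.mem_stabilizer_iff.1 (hsup ▸ Subgroup.mem_top k)⟩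
    · rw [(hind _ _ (hbij hA)).resolve_left hA, sup_bot_eq] at hsup
      exact ⟨a, ha, fun k => MulAction.mem_stabilizer_iff.1 (hsup ▸ Subgroup.mem_top k)⟩
  · push Not at hne
    obtain ⟨t, rfl⟩ := hne
    right
    obtain ⟨hsup, hbij⟩ :=
      hK.sup_eq_top_and_bijective_lift_zpowers hS hS1 ha hab htriv hlim.infinite_subgroup
    by_cases hA : MulAction.stabilizer K a = ⊥
    · exact ⟨t, by rwa [hA, bot_sup_eq] at hsup⟩
    · have := (hind _ _ (hbij hA)).resolve_left hA
      rw [Subgroup.zpowers_eq_bot] at this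
      subst this
      exact absurd hab (by simp)

/-! ### Adjoining roots -/

namespace RootExtensionData

variable {G : Type u} [Group G] {D : RootExtensionData.{u, v, w, x} G}

theorem fromRoot_incl (i : D.ι) (j : D.κ i) (e : D.E i) :
    D.fromRoot i j (D.incl i j e) = D.fromBase e := by
  symm
  rw [fromRoot, fromBase, MonoidHom.comp_apply, MonoidHom.comp_apply, ← mul_inv_eq_one, ← map_inv,
    ← map_mul, QuotientGroup.mk'_apply, QuotientGroup.eq_one_iff]
  exact Subgroup.subset_normalClosure ⟨i, j, e, rfl⟩

theorem eq_top_of_fromBase_of_fromRoot {L : Subgroup D.Adjunction}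
    (hG : ∀ g, D.fromBase g ∈ L) (hF : ∀ i j f, D.fromRoot i j f ∈ L) : L = ⊤ := by
  refine (Subgroup.eq_top_iff' L).2 fun z => ?_
  obtain ⟨y, rfl⟩ := QuotientGroup.mk'_surjective _ z
  induction y using Monoid.Coprod.induction_on with
  | inl g => exact hG g
  | inr y =>
    induction y using Monoid.CoprodI.induction_on with
    | one => rw [map_one, map_one]; exact L.one_mem
    | of p f => exact hF p.1 p.2 f
    | mul y z hy hz => rw [map_mul, map_mul]; exact L.mul_mem hy hz
  | mul y z hy hz => rw [map_mul]; exact L.mul_mem hy hz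

namespace IsAdjunctionOfRoots

variable {H : Type*} [Group H] {η : G →* H} {π : D.Adjunction →* H}

theorem map_fromBase (h : D.IsAdjunctionOfRoots η π) (g : G) : π (D.fromBase g) = η g :=
  DFunLike.congr_fun h.extends_incl g

theorem exists_pow_fromRoot_eq (h : D.IsAdjunctionOfRoots η π) (i : D.ι) (j : D.κ i)
    (f : D.F i j) : ∃ n : ℕ, n ≠ 0 ∧ ∃ e ∈ D.E i, π (D.fromRoot i j f) ^ n = η e := by
  obtain ⟨n, hn, -, e, he⟩ :=
    Subgroup.exists_pow_mem_of_index_ne_zero (D.finiteIndex i j).index_ne_zero f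
  refine ⟨n, hn.ne', e, e.2, ?_⟩
  rw [← map_pow, ← map_pow, ← he, fromRoot_incl, h.map_fromBase]

/-- The roots adjoined to `E i` commute with `E i`, as some of their powers do. -/
theorem commute_fromRoot (h : D.IsAdjunctionOfRoots η π) (hH : IsLimitGroup H) (i : D.ι)
    (j : D.κ i) (f : D.F i j) {e : G} (he : e ∈ D.E i) :
    Commute (π (D.fromRoot i j f)) (η e) := by
  obtain ⟨n, hn, d, hd, hfd⟩ := h.exists_pow_fromRoot_eq i j f
  refine hH.commute_of_pow_left hn ?_
  rw [hfd]
  exact (show Commute d e from D.abelian i d hd e he).map η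

/-- If `G` is infinite cyclic, then `H` is generated by elements having a nontrivial power in the
image of `G`; these commute with each other, so all elements of `H` have this property. -/
theorem exists_pow_mem_range_of_zpowers (h : D.IsAdjunctionOfRoots η π) (hH : IsLimitGroup H)
    {t : G} (ht : Subgroup.zpowers t = ⊤) (c : H) : ∃ n : ℕ, n ≠ 0 ∧ c ^ n ∈ η.range := by
  have hpow : ∀ z, Commute z (η t) → ∀ g : G, Commute z (η g) := by
    intro z hz g
    obtain ⟨n, rfl⟩ := Subgroup.mem_zpowers_iff.1 (ht ▸ Subgroup.mem_top g)
    rw [map_zpow]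
    exact hz.zpow_right n
  by_cases ht1 : η t = 1
  · -- the exceptional case of a trivial base group, to which no roots can be adjoined
    have hbot : ∀ g : G, g = 1 := by
      intro g
      obtain ⟨n, rfl⟩ := Subgroup.mem_zpowers_iff.1 (ht ▸ Subgroup.mem_top g)
      rw [h.injective (ht1.trans (map_one η).symm), one_zpow]
    have htop : η.range.comap π = ⊤ := by
      refine eq_top_of_fromBase_of_fromRoot (fun g => ⟨g, (h.map_fromBase g).symm⟩) ?_
      intro i
      refine absurd ?_ (D.nontrivial i)
      exact (Subgroup.eq_bot_iff_forall _).2 fun e _ => hbot e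
    obtain ⟨z, rfl⟩ := h.surjective c
    exact ⟨1, one_ne_zero, by
      rw [pow_one]; exact Subgroup.mem_comap.1 (htop ▸ Subgroup.mem_top z)⟩
  have hgen : ∀ i j (f : D.F i j), ∃ n : ℕ, n ≠ 0 ∧ π (D.fromRoot i j f) ^ n ∈ η.range := by
    intro i j f
    obtain ⟨n, hn, e, -, he⟩ := h.exists_pow_fromRoot_eq i j f
    exact ⟨n, hn, e, he.symm⟩
  have hcent : ∀ z : H, Commute z (η t) := by
    have htop : (Subgroup.centralizer {η t}).comap π = ⊤ := by
      refine eq_top_of_fromBase_of_fromRoot ?_ ?_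
      · intro g
        rw [Subgroup.mem_comap, h.map_fromBase, Subgroup.mem_centralizer_singleton_iff]
        exact (hpow _ (Commute.refl _) g).symm.eq
      · intro i j f
        rw [Subgroup.mem_comap, Subgroup.mem_centralizer_singleton_iff]
        obtain ⟨n, hn, e, he⟩ := hgen i j f
        refine (hH.commute_of_pow_left hn ?_).eq
        rw [← he]
        exact (hpow _ (Commute.refl _) e).symm
    intro z
    obtain ⟨y, rfl⟩ := h.surjective z
    exact Subgroup.mem_centralizer_singleton_iff.1
      (Subgroup.mem_comap.1 (htop ▸ Subgroup.mem_top y))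
  have hcomm : ∀ y z : H, Commute y z := fun y z =>
    hH.commute_trans ht1 (hcent y) (hcent z).symm
  let P : Subgroup H :=
    { carrier := {z | ∃ n : ℕ, n ≠ 0 ∧ z ^ n ∈ η.range}
      one_mem' := ⟨1, one_ne_zero, by rw [one_pow]; exact one_mem _⟩
      mul_mem' := by
        rintro y z ⟨n, hn, hy⟩ ⟨m, hm, hz⟩
        refine ⟨n * m, mul_ne_zero hn hm, ?_⟩
        rw [(hcomm y z).mul_pow, pow_mul, mul_comm n m, pow_mul]
        exact mul_mem (pow_mem hy m) (pow_mem hz n)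
      inv_mem' := by
        rintro y ⟨n, hn, hy⟩
        exact ⟨n, hn, by rw [inv_pow]; exact inv_mem hy⟩ }
  have htop : P.comap π = ⊤ := eq_top_of_fromBase_of_fromRoot
    (fun g => ⟨1, one_ne_zero, by rw [pow_one]; exact ⟨g, (h.map_fromBase g).symm⟩⟩) hgen
  obtain ⟨z, rfl⟩ := h.surjective c
  exact Subgroup.mem_comap.1 (htop ▸ Subgroup.mem_top z)

end IsAdjunctionOfRoots

end RootExtensionData

/-! ### Edge groups -/

theorem mem_edgeGroup {H : Type*} [Group H] {V : Type*} [MulAction H V] {K : Type*} [Group K]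
    {φ : K →* H} {a b : V} {k : K} : k ∈ edgeGroup φ a b ↔ φ k • a = a ∧ φ k • b = b := by
  simp [edgeGroup, Subgroup.mem_comap, Subgroup.mem_inf, MulAction.mem_stabilizer_iff]

theorem map_edgeGroup_le {H : Type*} [Group H] {V : Type*} [MulAction H V] {K : Type*} [Group K]
    (φ : K →* H) (a b : V) : (edgeGroup φ a b).map φ ≤ edgeGroup (MonoidHom.id H) a b := by
  rintro _ ⟨k, hk, rfl⟩
  exact mem_edgeGroup.2 (mem_edgeGroup.1 hk)

/-- If the `K`-stabilizer of an edge of `S` is the full stabilizer, then an element that takes an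
edge of `S` to an edge of `S` lies in the image of `K`. -/
theorem mem_range_of_edgeGroup_le {H : Type*} [Group H] {V : Type*} [MulAction H V]
    {T : SimpleGraph V} (hT : ActsOnTree H T) {K : Type*} [Group K] {φ : K →* H} {S : Set V}
    (hS1 : IsOneEdged T φ S) {a b : V} (ha : a ∈ S) (hb : b ∈ S) (hab : T.Adj a b)
    (hle : edgeGroup (MonoidHom.id H) a b ≤ (edgeGroup φ a b).map φ) {h : H} {c d : V}
    (hc : c ∈ S) (hd : d ∈ S) (hcd : T.Adj c d) (hhc : h • c ∈ S) (hhd : h • d ∈ S) :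
    h ∈ φ.range := by
  -- orient the edge from `c` to `d` as a translate of the edge from `a` to `b`
  wlog hor : ∃ k : K, φ k • a = c ∧ φ k • b = d generalizing c d
  · obtain ⟨k, hk | ⟨h1, h2⟩⟩ := hS1.2 a ha b hb c hc d hd hab hcd
    · exact absurd ⟨k, hk⟩ hor
    · exact this hd hc hcd.symm hhd hhc ⟨k, h1, h2⟩
  obtain ⟨k, rfl, rfl⟩ := hor
  obtain ⟨l, ⟨h1, h2⟩ | ⟨h1, h2⟩⟩ :=
    hS1.2 _ hc _ hd _ hhc _ hhd hcd (hT.adj_smul h _ _ hcd)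
  · have hmem : (φ k)⁻¹ * (φ l)⁻¹ * h * φ k ∈ edgeGroup (MonoidHom.id H) a b := by
      refine mem_edgeGroup.2 ⟨?_, ?_⟩
      · simp only [MonoidHom.id_apply, mul_smul]
        rw [← h1, inv_smul_smul, inv_smul_smul]
      · simp only [MonoidHom.id_apply, mul_smul]
        rw [← h2, inv_smul_smul, inv_smul_smul]
    obtain ⟨m, -, hm⟩ := hle hmem
    refine ⟨l * k * m * k⁻¹, ?_⟩
    rw [map_mul, map_mul, map_mul, map_inv, hm]
    group
  · refine absurd ⟨?_, ?_⟩ (hT.no_inversion ((φ l)⁻¹ * h) _ _ hcd)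
    · rw [mul_smul, ← h2, inv_smul_smul]
    · rw [mul_smul, ← h1, inv_smul_smul]

theorem Subgroup.isFiniteRelIndex_of_isCyclic {H : Type*} [Group H] {A B : Subgroup H}
    (hAB : A ≤ B) (hB : IsCyclic B) (hA : A ≠ ⊥) : A.IsFiniteRelIndex B := by
  obtain ⟨a, ha⟩ := A.ne_bot_iff_exists_ne_one.1 hA
  obtain ⟨b, hb⟩ := hB.exists_generator
  obtain ⟨n, hn⟩ := Subgroup.mem_zpowers_iff.1 (hb ⟨a, hAB a.2⟩)
  let _ := IsCyclic.commGroup (α := B)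
  have hn0 : n ≠ 0 := by
    rintro rfl
    rw [zpow_zero] at hn
    exact ha (Subtype.ext (congrArg Subtype.val hn).symm)
  let x : B ⧸ A.subgroupOf B := b
  have hx : IsOfFinOrder x := by
    refine isOfFinOrder_iff_zpow_eq_one.2 ⟨n, hn0, ?_⟩
    rw [← QuotientGroup.mk_zpow, hn, QuotientGroup.eq_one_iff]
    exact a.2
  have htop : Set.univ ⊆ (Subgroup.zpowers x : Set (B ⧸ A.subgroupOf B)) := by
    rintro y -
    obtain ⟨z, rfl⟩ := QuotientGroup.mk_surjective y
    obtain ⟨m, rfl⟩ := Subgroup.mem_zpowers_iff.1 (hb z)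
    exact ⟨m, rfl⟩
  have : Finite (B ⧸ A.subgroupOf B) :=
    Set.finite_univ_iff.1 ((finite_zpowers.2 hx).subset htop)
  exact ⟨(Subgroup.finiteIndex_of_finite_quotient (H := A.subgroupOf B)).index_ne_zero⟩

/-! ### Edge groups after adjoining a root to a hyperbolic subgroup -/

theorem mainTheorem7 {G : Type*} [Group G] {H : Type*} [Group H]
    (hG : IsLimitGroup G) (hH : IsLimitGroup H) (hGind : IsFreelyIndecomposable G)
    (D : RootExtensionData G) (η : G →* H) (π : D.Adjunction →* H)
    (hroots : D.IsAdjunctionOfRoots η π)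
    -- the splitting of `H`, and the splitting of `G` induced on the minimal subtree `S`
    {V : Type*} [MulAction H V] (T : SimpleGraph V) (hT : IsOneEdgedCyclicSplitting H T)
    (S : Set V) (hS : IsMinimalSubtree T η S) (hS1 : IsOneEdged T η S)
    -- some `E i` is hyperbolic in the induced splitting and a new root is adjoined to it
    (hhyp : ∃ i : D.ι, (∃ g ∈ D.E i, IsHyperbolicElement η S g) ∧
      ∃ j : D.κ i, ¬ (π.comp (D.fromRoot i j)).range ≤
        (Subgroup.centralizer (D.E i : Set G)).map η) :
    ∀ a ∈ S, ∀ b ∈ S, T.Adj a b →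
      (edgeGroup η a b).map η < edgeGroup (MonoidHom.id H) a b ∧
      ((edgeGroup η a b).map η).IsFiniteRelIndex (edgeGroup (MonoidHom.id H) a b) := by
  intro a ha b hb hab
  obtain ⟨i, ⟨g, hgE, hg⟩, j, hj⟩ := hhyp
  refine ⟨(map_edgeGroup_le η a b).lt_of_not_ge fun hle => hj ?_, ?_⟩
  · rintro _ ⟨f, rfl⟩
    rw [MonoidHom.comp_apply]
    set h := π (D.fromRoot i j f)
    have hcomm : ∀ e ∈ D.E i, Commute h (η e) := fun e he =>
      hroots.commute_fromRoot hH i j f he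
    suffices h ∈ η.range by
      obtain ⟨k, hk⟩ := this
      refine ⟨k, Subgroup.mem_centralizer_iff.2 fun e he => hroots.injective ?_, hk⟩
      rw [map_mul, map_mul, hk]
      exact (hcomm e he).symm.eq
    -- `S` and its translate by `h` are invariant under `g`, so they have an edge in common
    have hginv : ∀ c ∈ (fun v => h⁻¹ • v) '' S, η g • c ∈ (fun v => h⁻¹ • v) '' S := by
      rintro _ ⟨c, hc, rfl⟩
      refine ⟨η g • c, hS.invariant g c hc, ?_⟩
      simp only [← mul_smul]
      rw [((hcomm g hgE).inv_left).eq]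
    have hconn := hT.acts.connected_induce_image_smul hS.connected h⁻¹
    obtain ⟨c, ⟨hc, c', hc', hcc⟩, d, ⟨hd, d', hd', hdd⟩, hcd⟩ :=
      hT.acts.exists_adj_mem_inter_of_forall_smul_ne hS.connected hconn (g := η g)
        (hS.invariant g) (fun v hv => by rw [← map_inv]; exact hS.invariant g⁻¹ v hv) hginv hg
    refine mem_range_of_edgeGroup_le hT.acts hS1 ha hb hab hle hc hd hcd ?_ ?_
    · rw [← hcc]; simpa using hc'
    · rw [← hdd]; simpa using hd'
  · refine Subgroup.isFiniteRelIndex_of_isCyclic (map_edgeGroup_le η a b) (hT.cyclic a b hab)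
      fun hbot => ?_
    rw [Subgroup.map_eq_bot_iff_of_injective _ hroots.injective] at hbot
    have htriv : ∀ k : G, η k • a = a → η k • b = b → k = 1 := fun k h1 h2 =>
      Subgroup.mem_bot.1 (hbot ▸ mem_edgeGroup.2 ⟨h1, h2⟩)
    let _ : MulAction G V := MulAction.compHom V η
    have hGT : ActsOnTree G T :=
      ⟨hT.acts.isTree, fun k => hT.acts.adj_smul (η k), fun k => hT.acts.no_inversion (η k)⟩
    rcases hGind.exists_fixed_or_zpowers hG hGT (S := S) ⟨hS.connected, hS.invariant⟩ hS1
      ha hb hab htriv with ⟨c, hc, hfix⟩ | ⟨t, ht⟩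
    · exact hg c hc (hfix g)
    · -- a power of an element of the edge group of `H` would lie in the trivial edge group of `G`
      have := hT.infinite a b hab
      obtain ⟨⟨c, hc⟩, hc1⟩ := exists_ne (1 : edgeGroup (MonoidHom.id H) a b)
      obtain ⟨n, hn, k, hk⟩ := hroots.exists_pow_mem_range_of_zpowers hH ht c
      have hcn := mem_edgeGroup.1 (pow_mem hc n)
      rw [MonoidHom.id_apply, ← hk] at hcn
      rw [htriv k hcn.1 hcn.2, map_one] at hk
      exact hc1 (Subtype.ext (hH.eq_one_of_pow_eq_one hn hk.symm))
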